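/- Let $E=(E^0,E^1,r,s)$ be a topological graph: $E^0,E^1$ are locally compact Hausdorff spaces, $r\colon E^1\to E^0$ is continuous and $s\colon E^1\to E^0$ is a local homeomorphism. For $f\in C_0(E^0)$ and $x\in C_c(E^1)$ put $(f\cdot x)(e)=f(r(e))x(e)$ and $(x\cdot f)(e)=x(e)f(s(e))$. An $s$-section is a set $U\subseteq E^1$ such that $s|_U$ is a homeomorphism onto $s(U)$. If $\{e: x(e)\neq 0\}$ is an $s$-section, let $\widehat x\in C_0(E^0)$ be the function with $\widehat x(s(e))=|x(e)|^2$ when $x(e)\ne 0$, and $\widehat x(v)=0$ when $v\notin s(\{e:x(e)\neq 0\})$. A Toeplitz representation of $E$ in a $C^*$-algebra $B$ is a pair $(\psi,\pi)$ of a linear map $\psi\colon C_c(E^1)\to B$ and a $*$-homomorphism $\pi\colon C_0(E^0)\to B$ such that (1) $\psi(f\cdot x)=\pi(f)\psi(x)$ for all $f\in C_0(E^0)$ and $x\in C_c(E^1)$; (2) $\pi(\widehat x)=\psi(x)^*\psi(x)$ whenever $\operatorname{supp}(x)$ is contained in an open $s$-section; (3) $\psi(x)^*\psi(y)=0$ whenever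 $\operatorname{supp}(x)$ and $\operatorname{supp}(y)$ are contained in disjoint open $s$-sections. It is universal if for every Toeplitz representation $(\psi',\pi')$ of $E$ in a $C^*$-algebra $C$ there is a $*$-homomorphism $h\colon B\to C$ with $h\circ\psi=\psi'$ and $h\circ\pi=\pi'$. Let $X(E)$ be the graph correspondence of $E$: the $C^*$-correspondence over $C_0(E^0)$ obtained by completing $C_c(E^1)$, with the actions above and the inner product $\langle x,y\rangle(v)=\sum_{s(e)=v}\overline{x(e)}\,y(e)$, in the norm $\|x\|=\|\langle x,x\rangle\|^{1/2}$. A Toeplitz representation of $X(E)$ in $B$ is a pair of a linear map $\psi\colon X(E)\to B$ and a $*$-homomorphism $\pi\colon C_0(E^0)\to B$ with $\psi(f\cdot x)=\pi(f)\psi(x)$ and $\psi(x)^*\psi(y)=\pi(\langle x,y\rangle)$ for all $f\in C_0(E^0)$ and $x,y\in X(E)$; universality is defined as before. The Toeplitz algebra $\mathcal T(E)$ is the $C^*$-algebra generated by the image of a universal Toeplitz representation $(i_X,i_A)$ of $X(E)$. Then $\mathcal T(E)$ exists, and there is a universal Toeplitz representation $(i_1,i_0)$ of $E$ in $\mathcal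 T(E)$, namely $(i_X|_{C_c(E^1)},i_A)$, whose image generates $\mathcal T(E)$. Moreover, the $C^*$-algebra generated by the image of any universal Toeplitz representation of $E$ is isomorphic to $\mathcal T(E)$. -/

import Mathlib

open scoped ZeroAtInfty CompactlySupported ComplexConjugate

universe u v w

/-- A topological graph with vertex space `V` and edge space `W` (the spaces are required to be
locally compact Hausdorff where the graph is used). -/
structure TopologicalGraph (V : Type u) (W : Type v) [TopologicalSpace V] [TopologicalSpace W] where
  r : W → V
  s : W → V
  continuous_r : Continuous r
  isLocalHomeomorph_s : IsLocalHomeomorph s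

namespace TopologicalGraph

variable {V : Type u} {W : Type v} [TopologicalSpace V] [TopologicalSpace W]

/-- `U` is an `s`-section: `s` restricts to a homeomorphism of `U` onto `s(U)`. -/
def IsSSection (E : TopologicalGraph V W) (U : Set W) : Prop :=
  Topology.IsEmbedding (U.domRestrict E.s)

theorem IsSSection.mono {E : TopologicalGraph V W} {U U' : Set W} (h : E.IsSSection U)
    (hU : U' ⊆ U) : E.IsSSection U' :=
  h.comp (Topology.IsEmbedding.inclusion hU)

theorem IsSSection.injOn {E : TopologicalGraph V W} {U : Set W} (h : E.IsSSection U) :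
    Set.InjOn E.s U :=
  Set.injOn_iff_injective.2 h.injective

/-- The left action `(f · x)(e) = f(r(e)) x(e)`. -/
noncomputable def lact (E : TopologicalGraph V W) (f : C₀(V, ℂ)) (x : C_c(W, ℂ)) : C_c(W, ℂ) where
  toFun e := f (E.r e) * x e
  continuous_toFun := ((map_continuous f).comp E.continuous_r).mul (map_continuous x)
  hasCompactSupport' := x.hasCompactSupport.mul_left

/-- The right action `(x · f)(e) = x(e) f(s(e))`. -/
noncomputable def ract (E : TopologicalGraph V W) (x : C_c(W, ℂ)) (f : C₀(V, ℂ)) : C_c(W, ℂ) where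
  toFun e := x e * f (E.s e)
  continuous_toFun :=
    (map_continuous x).mul ((map_continuous f).comp E.isLocalHomeomorph_s.continuous)
  hasCompactSupport' := x.hasCompactSupport.mul_right

/-- `v ↦ ∑_{s(e) = v} g(e)`. -/
noncomputable def fibreSum (E : TopologicalGraph V W) (g : W → ℂ) (v : V) : ℂ :=
  ∑ᶠ e ∈ E.s ⁻¹' {v}, g e

open scoped Classical in
/-- The function `x̂`, with `x̂(s(e)) = |x(e)|²` for `e ∈ osupp(x)` and `x̂ = 0` off
`s(osupp(x))`, see `hatFun_apply` and `hatFun_eq_zero`. -/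
noncomputable def hatFun (E : TopologicalGraph V W) (x : C_c(W, ℂ)) (v : V) : ℂ :=
  if h : ∃ e ∈ Function.support x, E.s e = v then ((‖x h.choose‖ ^ 2 : ℝ) : ℂ) else 0

theorem hatFun_apply (E : TopologicalGraph V W) (x : C_c(W, ℂ))
    (hx : E.IsSSection (Function.support x)) {e : W} (he : e ∈ Function.support x) :
    E.hatFun x (E.s e) = ((‖x e‖ ^ 2 : ℝ) : ℂ) := by
  have h : ∃ e' ∈ Function.support x, E.s e' = E.s e := ⟨e, he, rfl⟩
  rw [hatFun, dif_pos h, hx.injOn h.choose_spec.1 he h.choose_spec.2]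

theorem hatFun_eq_zero (E : TopologicalGraph V W) (x : C_c(W, ℂ)) {v : V}
    (hv : v ∉ E.s '' Function.support x) : E.hatFun x v = 0 :=
  dif_neg hv

section

variable [T2Space V]

theorem finite_fibre (E : TopologicalGraph V W) {K : Set W} (hK : IsCompact K) (v : V) :
    (E.s ⁻¹' {v} ∩ K).Finite := by
  have hd : IsDiscrete (E.s ⁻¹' {v} ∩ K) := by
    refine ((E.isLocalHomeomorph_s.isLocalHomeomorphOn).mono
      (Set.subset_univ _)).isDiscrete_of_image ?_
    refine Set.Subsingleton.isDiscrete ?_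
    rintro _ ⟨a, ha, rfl⟩ _ ⟨b, hb, rfl⟩
    exact ha.1.trans hb.1.symm
  exact (hK.inter_left (isClosed_singleton.preimage
    E.isLocalHomeomorph_s.continuous)).finite hd

theorem fibreSum_eq_sum (E : TopologicalGraph V W) {K : Set W} (hK : IsCompact K) {g : W → ℂ}
    (hg : Function.support g ⊆ K) (v : V) :
    E.fibreSum g v = ∑ e ∈ (E.finite_fibre hK v).toFinset, g e := by
  refine finsum_mem_eq_sum_of_inter_support_eq g ?_
  ext e
  simp only [Set.mem_inter_iff, Set.Finite.coe_toFinset]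
  exact ⟨fun h => ⟨⟨h.1, hg h.2⟩, h.2⟩, fun h => ⟨h.1.1, h.2⟩⟩

/-- Continuity of the fibre sum for a function supported in the domain of a local inverse. -/
theorem continuous_fibreSum_of_subset (E : TopologicalGraph V W) (g : C_c(W, ℂ))
    (φ : OpenPartialHomeomorph W V) (hφ : E.s = φ) (hg : tsupport g ⊆ φ.source) :
    Continuous (E.fibreSum g) := by
  have h1 : ∀ v ∈ φ.target, E.fibreSum g v = g (φ.symm v) := by
    intro v hv
    rw [fibreSum, finsum_mem_eq_sum_of_inter_support_eq g (t := {φ.symm v}), Finset.sum_singleton]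
    ext e
    simp only [Set.mem_inter_iff, Set.mem_preimage, Set.mem_singleton_iff, Finset.coe_singleton,
      hφ]
    refine and_congr_left fun he => ⟨fun h => ?_, fun h => by rw [h, φ.right_inv hv]⟩
    rw [← h, φ.left_inv (hg (subset_tsupport _ he))]
  have h2 : Function.support (E.fibreSum g) ⊆ φ '' tsupport g := by
    intro v hv
    obtain ⟨e, he, h⟩ := exists_ne_zero_of_finsum_mem_ne_zero hv
    exact ⟨e, subset_tsupport _ h, by rw [← hφ]; exact he⟩
  have hc : IsCompact (φ '' tsupport g) :=
    g.hasCompactSupport.isCompact.image_of_continuousOn (φ.continuousOn.mono hg)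
  have h3 : tsupport (E.fibreSum g) ⊆ φ.target :=
    (closure_minimal h2 hc.isClosed).trans (by
      rintro _ ⟨e, he, rfl⟩
      exact φ.map_source (hg he))
  refine continuous_of_tsupport fun v hv => ?_
  have hv' := h3 hv
  refine ContinuousAt.congr (f := fun v => g (φ.symm v)) ?_ ?_
  · exact (map_continuous g).continuousAt.comp (φ.continuousAt_symm hv')
  · filter_upwards [φ.open_target.mem_nhds hv'] with w hw using (h1 w hw).symm

theorem hasCompactSupport_fibreSum (E : TopologicalGraph V W) (g : C_c(W, ℂ)) :
    HasCompactSupport (E.fibreSum g) := by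
  refine HasCompactSupport.intro
    (g.hasCompactSupport.isCompact.image E.isLocalHomeomorph_s.continuous) fun v hv => ?_
  by_contra h
  obtain ⟨e, he, h'⟩ := exists_ne_zero_of_finsum_mem_ne_zero h
  exact hv ⟨e, subset_tsupport _ h', he⟩

variable [T2Space W] [LocallyCompactSpace W]

theorem continuous_fibreSum (E : TopologicalGraph V W) (g : C_c(W, ℂ)) :
    Continuous (E.fibreSum g) := by
  choose φ hφ hs using E.isLocalHomeomorph_s
  have hK : IsCompact (tsupport g) := g.hasCompactSupport
  obtain ⟨t, ht⟩ := hK.elim_nhds_subcover' (fun e _ => (φ e).source)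
    (fun e _ => (φ e).open_source.mem_nhds (hφ e))
  let c : Fin t.card → W := fun i => (t.equivFin.symm i).1.1
  obtain ⟨f, hf, hsum, -, -⟩ := exists_continuous_sum_one_of_isOpen_isCompact
    (s := fun i => (φ (c i)).source) (fun i => (φ (c i)).open_source) hK (by
      intro e he
      obtain ⟨a, ha, h⟩ := Set.mem_iUnion₂.1 (ht he)
      exact Set.mem_iUnion.2 ⟨t.equivFin ⟨a, ha⟩, by simpa [c] using h⟩)
  let g' : Fin t.card → C_c(W, ℂ) := fun i =>
    { toFun := fun e => (f i e : ℂ) * g e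
      continuous_toFun := (Complex.continuous_ofReal.comp (f i).continuous).mul (map_continuous g)
      hasCompactSupport' := g.hasCompactSupport.mul_left }
  have hsub : ∀ i, Function.support (g' i) ⊆ tsupport g := fun i e he =>
    subset_tsupport _ (right_ne_zero_of_mul (show (f i e : ℂ) * g e ≠ 0 from he))
  have key : E.fibreSum g = fun v => ∑ i, E.fibreSum (g' i) v := by
    funext v
    rw [E.fibreSum_eq_sum hK (subset_tsupport _)]
    simp_rw [E.fibreSum_eq_sum hK (hsub _)]
    rw [Finset.sum_comm]
    refine Finset.sum_congr rfl fun e he => ?_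
    have h1 : ∑ i, f i e = 1 := by
      have := hsum ((E.finite_fibre hK v).mem_toFinset.1 he).2
      simpa using this
    have h2 : ∀ i, g' i e = (f i e : ℂ) * g e := fun i => rfl
    simp_rw [h2]
    rw [← Finset.sum_mul, ← Complex.ofReal_sum, h1, Complex.ofReal_one, one_mul]
  rw [key]
  refine continuous_finsetSum _ fun i _ => ?_
  refine E.continuous_fibreSum_of_subset (g' i) (φ (c i)) (hs _) ?_
  refine subset_trans (closure_mono ?_) (hf i)
  intro e he h
  exact he (by change (f i e : ℂ) * g e = 0; rw [h]; simp)

/-- The inner product `⟨x, y⟩(v) = ∑_{s(e) = v} conj (x(e)) y(e)` on `C_c(W)`, with values in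
`C₀(V)`. -/
noncomputable def ip (E : TopologicalGraph V W) (x y : C_c(W, ℂ)) : C₀(V, ℂ) where
  toFun := E.fibreSum fun e => conj (x e) * y e
  continuous_toFun := E.continuous_fibreSum (star x * y)
  zero_at_infty' := (E.hasCompactSupport_fibreSum (star x * y)).is_zero_at_infty

theorem ip_apply (E : TopologicalGraph V W) (x y : C_c(W, ℂ)) (v : V) :
    E.ip x y v = ∑ᶠ e ∈ E.s ⁻¹' {v}, conj (x e) * y e := rfl

theorem hatFun_eq_ip (E : TopologicalGraph V W) (x : C_c(W, ℂ))
    (hx : E.IsSSection (Function.support x)) : E.hatFun x = E.ip x x := by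
  funext v
  rw [ip_apply]
  by_cases hv : v ∈ E.s '' Function.support x
  · obtain ⟨e, he, rfl⟩ := hv
    rw [hatFun_apply E x hx he,
      finsum_mem_eq_sum_of_inter_support_eq (fun e => conj (x e) * x e) (t := {e}),
      Finset.sum_singleton, ← Complex.normSq_eq_conj_mul_self, Complex.normSq_eq_norm_sq]
    ext e'
    simp only [Set.mem_inter_iff, Set.mem_preimage, Set.mem_singleton_iff, Finset.coe_singleton]
    refine and_congr_left fun he' => ⟨fun h => ?_, fun h => by rw [h]⟩
    exact hx.injOn (right_ne_zero_of_mul (Function.mem_support.1 he')) he h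
  · rw [hatFun_eq_zero E x hv, finsum_mem_of_eqOn_zero]
    intro e he
    by_cases h : x e = 0
    · simp [h]
    · exact absurd ⟨e, h, he⟩ hv

/-- `x̂` as an element of `C₀(V)`. -/
noncomputable def hat (E : TopologicalGraph V W) (x : C_c(W, ℂ))
    (hx : E.IsSSection (Function.support x)) : C₀(V, ℂ) where
  toFun := E.hatFun x
  continuous_toFun := by
    rw [E.hatFun_eq_ip x hx]
    exact map_continuous _
  zero_at_infty' := by
    rw [E.hatFun_eq_ip x hx]
    exact zero_at_infty (E.ip x x)

end

end TopologicalGraph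

/-- A `C*`-correspondence over a `C*`-algebra `A`: a right Hilbert `A`-module `X` (complete in the
norm `‖x‖² = ‖⟨x, x⟩‖`) with a left action of `A` by adjointable operators. In a `C*`-algebra the
positive elements are those of the form `a* a`. -/
class CStarCorrespondence (A : Type u) (X : Type v) [NonUnitalCStarAlgebra A]
    [NormedAddCommGroup X] [NormedSpace ℂ X] [CompleteSpace X] where
  /-- the right action, `ract x a = x · a` -/
  ract : X →ₗ[ℂ] A →ₗ[ℂ] X
  /-- the left action, `lact a x = a · x` -/
  lact : A →ₗ[ℂ] X →ₗ[ℂ] X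
  /-- the inner product -/
  ip : X → X → A
  ract_mul : ∀ x a b, ract x (a * b) = ract (ract x a) b
  lact_mul : ∀ a b x, lact (a * b) x = lact a (lact b x)
  ip_add_right : ∀ x y z, ip x (y + z) = ip x y + ip x z
  ip_smul_right : ∀ (c : ℂ) x y, ip x (c • y) = c • ip x y
  ip_ract_right : ∀ x y a, ip x (ract y a) = ip x y * a
  star_ip : ∀ x y, star (ip x y) = ip y x
  ip_self_nonneg : ∀ x, ∃ a, ip x x = star a * a
  eq_zero_of_ip_self : ∀ x, ip x x = 0 → x = 0
  norm_sq : ∀ x, ‖x‖ ^ 2 = ‖ip x x‖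
  ip_lact : ∀ a x y, ip (lact (star a) y) x = ip y (lact a x)

section ZeroAtInfty

variable {V : Type u} [TopologicalSpace V]

theorem ZeroAtInftyContinuousMap.norm_le_of_forall {f : C₀(V, ℂ)} {C : ℝ} (hC : 0 ≤ C)
    (h : ∀ v, ‖f v‖ ≤ C) : ‖f‖ ≤ C := by
  rw [← ZeroAtInftyContinuousMap.norm_toBCF_eq_norm]
  exact (BoundedContinuousFunction.norm_le hC).2 h

theorem ZeroAtInftyContinuousMap.norm_apply_le (f : C₀(V, ℂ)) (v : V) : ‖f v‖ ≤ ‖f‖ := by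
  rw [← ZeroAtInftyContinuousMap.norm_toBCF_eq_norm]
  exact f.toBCF.norm_coe_le_norm v

theorem ZeroAtInftyContinuousMap.continuous_eval (v : V) :
    Continuous fun f : C₀(V, ℂ) => f v := by
  refine LipschitzWith.continuous (K := 1) (LipschitzWith.of_dist_le_mul fun f g => ?_)
  rw [NNReal.coe_one, one_mul, dist_eq_norm, dist_eq_norm]
  exact (f - g).norm_apply_le v

theorem ZeroAtInftyContinuousMap.exists_star_mul_self {f : C₀(V, ℂ)}
    (hf : ∀ v, ∃ t : ℝ, 0 ≤ t ∧ f v = t) : ∃ a : C₀(V, ℂ), f = star a * a := by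
  have h0 : Filter.Tendsto (fun v => ((√‖f v‖ : ℝ) : ℂ)) (Filter.cocompact V) (nhds 0) := by
    have h1 : Filter.Tendsto (fun v => √‖f v‖) (Filter.cocompact V) (nhds (√‖(0 : ℂ)‖)) :=
      (Real.continuous_sqrt.tendsto _).comp ((continuous_norm.tendsto _).comp (zero_at_infty f))
    have h2 := (Complex.continuous_ofReal.tendsto _).comp h1
    simpa [Function.comp_def] using h2
  refine ⟨⟨⟨fun v => ((√‖f v‖ : ℝ) : ℂ), ?_⟩, h0⟩, ?_⟩
  · exact Complex.continuous_ofReal.comp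
      (Real.continuous_sqrt.comp (continuous_norm.comp (map_continuous f)))
  · ext v
    obtain ⟨t, ht, h⟩ := hf v
    change f v = star ((√‖f v‖ : ℝ) : ℂ) * ((√‖f v‖ : ℝ) : ℂ)
    rw [h, Complex.norm_real, Real.norm_of_nonneg ht, Complex.star_def, Complex.conj_ofReal,
      ← Complex.ofReal_mul, Real.mul_self_sqrt ht]

end ZeroAtInfty

namespace TopologicalGraph

variable {V : Type u} {W : Type v} [TopologicalSpace V] [TopologicalSpace W]
  [T2Space V] [T2Space W] [LocallyCompactSpace W]

theorem ip_eq_sum (E : TopologicalGraph V W) {K : Set W} (hK : IsCompact K) {x y : C_c(W, ℂ)}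
    (hy : Function.support y ⊆ K) (v : V) :
    E.ip x y v = ∑ e ∈ (E.finite_fibre hK v).toFinset, conj (x e) * y e :=
  E.fibreSum_eq_sum hK (fun _ he => hy (right_ne_zero_of_mul he)) v

theorem ip_self_apply (E : TopologicalGraph V W) {K : Set W} (hK : IsCompact K) {x : C_c(W, ℂ)}
    (hx : Function.support x ⊆ K) (v : V) :
    E.ip x x v = ((∑ e ∈ (E.finite_fibre hK v).toFinset, ‖x e‖ ^ 2 : ℝ) : ℂ) := by
  rw [E.ip_eq_sum hK hx, Complex.ofReal_sum]
  exact Finset.sum_congr rfl fun e _ => by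
    rw [← Complex.normSq_eq_conj_mul_self, Complex.normSq_eq_norm_sq]

theorem sum_le_norm_ip_self (E : TopologicalGraph V W) {K : Set W} (hK : IsCompact K)
    {x : C_c(W, ℂ)} (hx : Function.support x ⊆ K) (v : V) :
    ∑ e ∈ (E.finite_fibre hK v).toFinset, ‖x e‖ ^ 2 ≤ ‖E.ip x x‖ := by
  have h := (E.ip x x).norm_apply_le v
  rwa [E.ip_self_apply hK hx, Complex.norm_real, Real.norm_of_nonneg
    (Finset.sum_nonneg fun _ _ => sq_nonneg _)] at h

theorem ip_add_right (E : TopologicalGraph V W) (x y z : C_c(W, ℂ)) :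
    E.ip x (y + z) = E.ip x y + E.ip x z := by
  have hK : IsCompact (tsupport y ∪ tsupport z) :=
    y.hasCompactSupport.isCompact.union z.hasCompactSupport.isCompact
  have hy : Function.support y ⊆ tsupport y ∪ tsupport z :=
    (subset_tsupport _).trans Set.subset_union_left
  have hz : Function.support z ⊆ tsupport y ∪ tsupport z :=
    (subset_tsupport _).trans Set.subset_union_right
  ext v
  rw [ZeroAtInftyContinuousMap.add_apply, E.ip_eq_sum hK hy, E.ip_eq_sum hK hz,
    E.ip_eq_sum hK ((Function.support_add _ _).trans (Set.union_subset hy hz)),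
    ← Finset.sum_add_distrib]
  exact Finset.sum_congr rfl fun e _ => mul_add _ _ _

theorem ip_smul_right (E : TopologicalGraph V W) (c : ℂ) (x y : C_c(W, ℂ)) :
    E.ip x (c • y) = c • E.ip x y := by
  have hK : IsCompact (tsupport y) := y.hasCompactSupport
  have hy : Function.support (c • y) ⊆ tsupport y := fun e he =>
    subset_tsupport _ (right_ne_zero_of_mul (show c * y e ≠ 0 from he))
  ext v
  rw [ZeroAtInftyContinuousMap.smul_apply, E.ip_eq_sum hK hy, E.ip_eq_sum hK (subset_tsupport _),
    Finset.smul_sum]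
  exact Finset.sum_congr rfl fun e _ => mul_left_comm _ _ _

theorem star_ip (E : TopologicalGraph V W) (x y : C_c(W, ℂ)) :
    star (E.ip x y) = E.ip y x := by
  have hK : IsCompact (tsupport x ∪ tsupport y) :=
    x.hasCompactSupport.isCompact.union y.hasCompactSupport.isCompact
  ext v
  rw [ZeroAtInftyContinuousMap.star_apply,
    E.ip_eq_sum hK ((subset_tsupport _).trans Set.subset_union_right),
    E.ip_eq_sum hK ((subset_tsupport _).trans Set.subset_union_left), star_sum]
  refine Finset.sum_congr rfl fun e _ => ?_
  rw [star_mul, Complex.star_def, Complex.conj_conj]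

theorem ip_ract_right (E : TopologicalGraph V W) (x y : C_c(W, ℂ)) (f : C₀(V, ℂ)) :
    E.ip x (E.ract y f) = E.ip x y * f := by
  have hK : IsCompact (tsupport y) := y.hasCompactSupport
  have hy : Function.support (E.ract y f) ⊆ tsupport y := fun e he =>
    subset_tsupport _ (left_ne_zero_of_mul (show y e * f (E.s e) ≠ 0 from he))
  ext v
  rw [ZeroAtInftyContinuousMap.mul_apply, E.ip_eq_sum hK hy, E.ip_eq_sum hK (subset_tsupport _),
    Finset.sum_mul]
  refine Finset.sum_congr rfl fun e he => ?_
  have h : E.s e = v := ((E.finite_fibre hK v).mem_toFinset.1 he).1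
  change conj (x e) * (y e * f (E.s e)) = _
  rw [h, mul_assoc]

theorem ip_lact (E : TopologicalGraph V W) (f : C₀(V, ℂ)) (x y : C_c(W, ℂ)) :
    E.ip (E.lact (star f) y) x = E.ip y (E.lact f x) := by
  ext v
  rw [ip_apply, ip_apply]
  refine finsum_mem_congr rfl fun e _ => ?_
  change conj (star (f (E.r e)) * y e) * x e = conj (y e) * (f (E.r e) * x e)
  rw [map_mul, Complex.star_def, Complex.conj_conj]
  ring

theorem ip_self_eq_zero (E : TopologicalGraph V W) {x : C_c(W, ℂ)} (h : E.ip x x = 0) :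
    x = 0 := by
  have hK : IsCompact (tsupport x) := x.hasCompactSupport
  ext e
  by_contra he
  have h1 : ∑ e ∈ (E.finite_fibre hK (E.s e)).toFinset, ‖x e‖ ^ 2 ≤ 0 := by
    have h2 := E.sum_le_norm_ip_self hK (subset_tsupport x) (E.s e)
    rwa [h, norm_zero] at h2
  have h3 : ‖x e‖ ^ 2 ≤ ∑ e ∈ (E.finite_fibre hK (E.s e)).toFinset, ‖x e‖ ^ 2 :=
    Finset.single_le_sum (f := fun e => ‖x e‖ ^ 2) (fun _ _ => sq_nonneg _)
      ((E.finite_fibre hK (E.s e)).mem_toFinset.2 ⟨rfl, subset_tsupport _ he⟩)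
  have h4 : 0 < ‖x e‖ ^ 2 := pow_pos (norm_pos_iff.2 he) 2
  linarith

theorem norm_ip_le (E : TopologicalGraph V W) (x y : C_c(W, ℂ)) :
    ‖E.ip x y‖ ≤ √‖E.ip x x‖ * √‖E.ip y y‖ := by
  have hK : IsCompact (tsupport x ∪ tsupport y) :=
    x.hasCompactSupport.isCompact.union y.hasCompactSupport.isCompact
  have hx : Function.support x ⊆ tsupport x ∪ tsupport y :=
    (subset_tsupport _).trans Set.subset_union_left
  have hy : Function.support y ⊆ tsupport x ∪ tsupport y :=
    (subset_tsupport _).trans Set.subset_union_right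
  refine ZeroAtInftyContinuousMap.norm_le_of_forall (by positivity) fun v => ?_
  rw [E.ip_eq_sum hK hy]
  refine (norm_sum_le _ _).trans ?_
  simp_rw [norm_mul, RCLike.norm_conj]
  refine (Real.sum_mul_le_sqrt_mul_sqrt _ _ _).trans ?_
  exact mul_le_mul (Real.sqrt_le_sqrt (E.sum_le_norm_ip_self hK hx v))
    (Real.sqrt_le_sqrt (E.sum_le_norm_ip_self hK hy v)) (Real.sqrt_nonneg _) (Real.sqrt_nonneg _)

theorem norm_ip_self_le_of_le (E : TopologicalGraph V W) {x y : C_c(W, ℂ)} {C : ℝ} (hC : 0 ≤ C)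
    (h : ∀ e, ‖y e‖ ≤ C * ‖x e‖) : √‖E.ip y y‖ ≤ C * √‖E.ip x x‖ := by
  have hK : IsCompact (tsupport x) := x.hasCompactSupport
  have hy : Function.support y ⊆ tsupport x := fun e he => by
    refine subset_tsupport _ fun h0 => he ?_
    have h1 := h e
    rw [h0, norm_zero, mul_zero] at h1
    exact norm_le_zero_iff.1 h1
  rw [← Real.sqrt_sq hC, ← Real.sqrt_mul (sq_nonneg C)]
  refine Real.sqrt_le_sqrt (ZeroAtInftyContinuousMap.norm_le_of_forall (by positivity) fun v => ?_)
  rw [E.ip_self_apply hK hy, Complex.norm_real, Real.norm_of_nonneg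
    (Finset.sum_nonneg fun _ _ => sq_nonneg _)]
  refine le_trans ?_ (mul_le_mul_of_nonneg_left
    (E.sum_le_norm_ip_self hK (subset_tsupport x) v) (sq_nonneg C))
  rw [Finset.mul_sum]
  refine Finset.sum_le_sum fun e _ => ?_
  rw [← mul_pow]
  exact pow_le_pow_left₀ (norm_nonneg _) (h e) 2

theorem ip_add_left (E : TopologicalGraph V W) (x y z : C_c(W, ℂ)) :
    E.ip (x + y) z = E.ip x z + E.ip y z := by
  rw [← E.star_ip z, E.ip_add_right, star_add, E.star_ip, E.star_ip]

theorem ip_smul_left (E : TopologicalGraph V W) (c : ℂ) (x y : C_c(W, ℂ)) :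
    E.ip (c • x) y = conj c • E.ip x y := by
  rw [← E.star_ip y, E.ip_smul_right, star_smul, E.star_ip, Complex.star_def]

theorem sqrt_norm_ip_smul (E : TopologicalGraph V W) (c : ℂ) (x : C_c(W, ℂ)) :
    √‖E.ip (c • x) (c • x)‖ = ‖c‖ * √‖E.ip x x‖ := by
  rw [E.ip_smul_right, E.ip_smul_left, smul_smul, norm_smul, norm_mul, RCLike.norm_conj,
    Real.sqrt_mul (mul_self_nonneg _), Real.sqrt_mul_self (norm_nonneg _)]

theorem sqrt_norm_ip_add (E : TopologicalGraph V W) (x y : C_c(W, ℂ)) :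
    √‖E.ip (x + y) (x + y)‖ ≤ √‖E.ip x x‖ + √‖E.ip y y‖ := by
  rw [Real.sqrt_le_left (by positivity), E.ip_add_left, E.ip_add_right, E.ip_add_right]
  refine (norm_add_le _ _).trans ((add_le_add (norm_add_le _ _) (norm_add_le _ _)).trans ?_)
  have h1 := E.norm_ip_le x y
  have h2 := E.norm_ip_le y x
  have h3 := Real.sq_sqrt (norm_nonneg (E.ip x x))
  have h4 := Real.sq_sqrt (norm_nonneg (E.ip y y))
  nlinarith

theorem sqrt_norm_ip_eq_zero (E : TopologicalGraph V W) (x : C_c(W, ℂ)) :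
    √‖E.ip x x‖ = 0 ↔ x = 0 := by
  rw [Real.sqrt_eq_zero (norm_nonneg _), norm_eq_zero]
  refine ⟨E.ip_self_eq_zero, ?_⟩
  rintro rfl
  simpa using E.ip_smul_right 0 0 0

/-- The space `C_c(W)`, to be normed by `‖x‖² = ‖⟨x, x⟩‖`. -/
def PreModule (_E : TopologicalGraph V W) : Type v := C_c(W, ℂ)

noncomputable instance (E : TopologicalGraph V W) : AddCommGroup E.PreModule :=
  inferInstanceAs (AddCommGroup C_c(W, ℂ))

noncomputable instance (E : TopologicalGraph V W) : Module ℂ E.PreModule :=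
  inferInstanceAs (Module ℂ C_c(W, ℂ))

noncomputable instance (E : TopologicalGraph V W) : Norm E.PreModule :=
  ⟨fun x => √‖E.ip x x‖⟩

theorem PreModule.core (E : TopologicalGraph V W) : NormedSpace.Core ℂ E.PreModule where
  norm_nonneg _ := Real.sqrt_nonneg _
  norm_smul := E.sqrt_norm_ip_smul
  norm_triangle := E.sqrt_norm_ip_add
  norm_eq_zero_iff := E.sqrt_norm_ip_eq_zero

noncomputable instance (E : TopologicalGraph V W) : NormedAddCommGroup E.PreModule :=
  NormedAddCommGroup.ofCore (PreModule.core E)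

noncomputable instance (E : TopologicalGraph V W) : NormedSpace ℂ E.PreModule :=
  NormedSpace.ofCore (PreModule.core E)

/-- The identity map from `C_c(W)` to the normed space `PreModule`. -/
noncomputable def ofCc (E : TopologicalGraph V W) : C_c(W, ℂ) ≃ₗ[ℂ] E.PreModule :=
  LinearEquiv.refl ℂ C_c(W, ℂ)

theorem norm_ofCc (E : TopologicalGraph V W) (x : C_c(W, ℂ)) :
    ‖E.ofCc x‖ = √‖E.ip x x‖ := rfl

/-- The underlying Banach space of the graph correspondence `X(E)`: the completion of `C_c(W)` in
the norm `‖x‖² = ‖⟨x, x⟩‖`. -/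
def Corr (E : TopologicalGraph V W) : Type v := UniformSpace.Completion E.PreModule

noncomputable instance (E : TopologicalGraph V W) : NormedAddCommGroup E.Corr :=
  inferInstanceAs (NormedAddCommGroup (UniformSpace.Completion E.PreModule))

noncomputable instance (E : TopologicalGraph V W) : NormedSpace ℂ E.Corr :=
  inferInstanceAs (NormedSpace ℂ (UniformSpace.Completion E.PreModule))

instance (E : TopologicalGraph V W) : CompleteSpace E.Corr :=
  inferInstanceAs (CompleteSpace (UniformSpace.Completion E.PreModule))

/-- The inclusion of `C_c(W)` in `X(E)`. -/
noncomputable def toCorr (E : TopologicalGraph V W) : C_c(W, ℂ) →ₗ[ℂ] E.Corr :=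
  (UniformSpace.Completion.toComplL (𝕜 := ℂ) (E := E.PreModule)).toLinearMap ∘ₗ
    E.ofCc.toLinearMap

theorem denseRange_toCorr (E : TopologicalGraph V W) : DenseRange E.toCorr :=
  (UniformSpace.Completion.denseRange_coe (α := E.PreModule)).comp E.ofCc.surjective.denseRange
    (UniformSpace.Completion.continuous_coe E.PreModule)

/-- The inner product of `C_c(W)` as a bounded sesquilinear map. -/
noncomputable def preIp (E : TopologicalGraph V W) :
    E.PreModule →L⋆[ℂ] E.PreModule →L[ℂ] C₀(V, ℂ) :=
  LinearMap.mkContinuous₂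
    (LinearMap.mk₂'ₛₗ (starRingEnd ℂ) (RingHom.id ℂ)
      (fun x y => E.ip (E.ofCc.symm x) (E.ofCc.symm y))
      (fun x y z => by rw [map_add, E.ip_add_left])
      (fun c x y => by rw [map_smul, E.ip_smul_left])
      (fun x y z => by rw [map_add, E.ip_add_right])
      (fun c x y => by rw [map_smul, E.ip_smul_right, RingHom.id_apply]))
    1 (fun x y => by
      rw [one_mul]
      exact E.norm_ip_le _ _)

theorem continuous_preIp (E : TopologicalGraph V W) :
    Continuous fun p : E.PreModule × E.PreModule => E.preIp p.1 p.2 :=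
  (E.preIp.continuous.comp continuous_fst).clm_apply continuous_snd

/-- The inner product of `C_c(W)` as a biadditive map. -/
noncomputable def preIpHom (E : TopologicalGraph V W) :
    E.PreModule →+ E.PreModule →+ C₀(V, ℂ) :=
  AddMonoidHom.mk' (fun x => (E.preIp x).toLinearMap.toAddMonoidHom) fun x y => by
    ext1 z
    exact congrArg (fun F : E.PreModule →L[ℂ] C₀(V, ℂ) => F z) (map_add E.preIp x y)

theorem continuous_preIpHom (E : TopologicalGraph V W) :
    Continuous fun p : E.PreModule × E.PreModule => E.preIpHom p.1 p.2 :=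
  E.continuous_preIp

/-- The inner product of `X(E)`: the continuous extension of that of `C_c(W)`. -/
noncomputable def corrIp (E : TopologicalGraph V W) (x y : E.Corr) : C₀(V, ℂ) :=
  ((UniformSpace.Completion.isDenseInducing_toCompl E.PreModule).prodMap
    (UniformSpace.Completion.isDenseInducing_toCompl E.PreModule)).extend
      (fun p : E.PreModule × E.PreModule => E.preIpHom p.1 p.2) (x, y)

theorem continuous_corrIp (E : TopologicalGraph V W) :
    Continuous fun p : E.Corr × E.Corr => E.corrIp p.1 p.2 :=
  (UniformSpace.Completion.isDenseInducing_toCompl E.PreModule).extend_Z_bilin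
    (UniformSpace.Completion.isDenseInducing_toCompl E.PreModule) E.continuous_preIpHom

theorem corrIp_toCorr (E : TopologicalGraph V W) (x y : C_c(W, ℂ)) :
    E.corrIp (E.toCorr x) (E.toCorr y) = E.ip x y :=
  ((UniformSpace.Completion.isDenseInducing_toCompl E.PreModule).prodMap
    (UniformSpace.Completion.isDenseInducing_toCompl E.PreModule)).extend_eq
      E.continuous_preIpHom (E.ofCc x, E.ofCc y)

theorem norm_toCorr (E : TopologicalGraph V W) (x : C_c(W, ℂ)) :
    ‖E.toCorr x‖ = √‖E.ip x x‖ :=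
  (UniformSpace.Completion.norm_coe (E.ofCc x)).trans (E.norm_ofCc x)

/-- The left action of `f` on `C_c(W)` as a bounded operator. -/
noncomputable def preLact (E : TopologicalGraph V W) (f : C₀(V, ℂ)) :
    E.PreModule →L[ℂ] E.PreModule :=
  LinearMap.mkContinuous
    { toFun := fun x => E.ofCc (E.lact f (E.ofCc.symm x))
      map_add' := fun x y => by
        rw [← map_add, map_add E.ofCc.symm]
        congr 1
        ext e
        exact mul_add _ _ _
      map_smul' := fun c x => by
        rw [RingHom.id_apply, ← map_smul, map_smul E.ofCc.symm]
        congr 1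
        ext e
        exact mul_left_comm _ _ _ }
    ‖f‖ fun x => E.norm_ip_self_le_of_le (norm_nonneg f) fun e =>
      (norm_mul_le _ _).trans (mul_le_mul_of_nonneg_right (f.norm_apply_le _) (norm_nonneg _))

/-- The right action of `f` on `C_c(W)` as a bounded operator. -/
noncomputable def preRact (E : TopologicalGraph V W) (f : C₀(V, ℂ)) :
    E.PreModule →L[ℂ] E.PreModule :=
  LinearMap.mkContinuous
    { toFun := fun x => E.ofCc (E.ract (E.ofCc.symm x) f)
      map_add' := fun x y => by
        rw [← map_add, map_add E.ofCc.symm]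
        congr 1
        ext e
        exact add_mul _ _ _
      map_smul' := fun c x => by
        rw [RingHom.id_apply, ← map_smul, map_smul E.ofCc.symm]
        congr 1
        ext e
        exact mul_assoc _ _ _ }
    ‖f‖ fun x => E.norm_ip_self_le_of_le (norm_nonneg f) fun e => by
      refine (norm_mul_le _ _).trans ?_
      rw [mul_comm]
      exact mul_le_mul_of_nonneg_right (f.norm_apply_le _) (norm_nonneg _)

/-- The left action of `f` on `X(E)` as a bounded operator. -/
noncomputable def corrLactL (E : TopologicalGraph V W) (f : C₀(V, ℂ)) : E.Corr →L[ℂ] E.Corr :=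
  (E.preLact f).completion

/-- The right action of `f` on `X(E)` as a bounded operator. -/
noncomputable def corrRactL (E : TopologicalGraph V W) (f : C₀(V, ℂ)) : E.Corr →L[ℂ] E.Corr :=
  (E.preRact f).completion

theorem corrLactL_toCorr (E : TopologicalGraph V W) (f : C₀(V, ℂ)) (x : C_c(W, ℂ)) :
    E.corrLactL f (E.toCorr x) = E.toCorr (E.lact f x) :=
  ContinuousLinearMap.completion_apply_coe (E.preLact f) (E.ofCc x)

theorem corrRactL_toCorr (E : TopologicalGraph V W) (f : C₀(V, ℂ)) (x : C_c(W, ℂ)) :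
    E.corrRactL f (E.toCorr x) = E.toCorr (E.ract x f) :=
  ContinuousLinearMap.completion_apply_coe (E.preRact f) (E.ofCc x)

/-- The left action of `C₀(V)` on `X(E)`, extending `(f · x)(e) = f(r(e)) x(e)`. -/
noncomputable def corrLact (E : TopologicalGraph V W) : C₀(V, ℂ) →ₗ[ℂ] E.Corr →ₗ[ℂ] E.Corr :=
  LinearMap.mk₂ ℂ (fun f x => E.corrLactL f x)
    (fun f g x => E.denseRange_toCorr.induction_on x
      (isClosed_eq (by fun_prop) (by fun_prop)) fun x => by
        simp only [corrLactL_toCorr]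
        rw [← map_add]
        congr 1
        ext e
        exact add_mul _ _ _)
    (fun c f x => E.denseRange_toCorr.induction_on x
      (isClosed_eq (E.corrLactL _).continuous
        ((E.corrLactL f).continuous.const_smul c)) fun x => by
        simp only [corrLactL_toCorr]
        rw [← map_smul]
        congr 1
        ext e
        exact mul_assoc _ _ _)
    (fun f x y => map_add _ x y)
    (fun c f x => map_smul _ c x)

/-- The right action of `C₀(V)` on `X(E)`, extending `(x · f)(e) = x(e) f(s(e))`. -/
noncomputable def corrRact (E : TopologicalGraph V W) : E.Corr →ₗ[ℂ] C₀(V, ℂ) →ₗ[ℂ] E.Corr :=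
  LinearMap.mk₂ ℂ (fun x f => E.corrRactL f x)
    (fun x y f => map_add _ x y)
    (fun c x f => map_smul _ c x)
    (fun x f g => E.denseRange_toCorr.induction_on x
      (isClosed_eq (by fun_prop) (by fun_prop)) fun x => by
        simp only [corrRactL_toCorr]
        rw [← map_add]
        congr 1
        ext e
        exact mul_add _ _ _)
    (fun c x f => E.denseRange_toCorr.induction_on x
      (isClosed_eq (E.corrRactL _).continuous
        ((E.corrRactL f).continuous.const_smul c)) fun x => by
        simp only [corrRactL_toCorr]
        rw [← map_smul]
        congr 1
        ext e
        exact mul_left_comm _ _ _)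

theorem corrLact_toCorr (E : TopologicalGraph V W) (f : C₀(V, ℂ)) (x : C_c(W, ℂ)) :
    E.corrLact f (E.toCorr x) = E.toCorr (E.lact f x) :=
  E.corrLactL_toCorr f x

theorem corrRact_toCorr (E : TopologicalGraph V W) (x : C_c(W, ℂ)) (f : C₀(V, ℂ)) :
    E.corrRact (E.toCorr x) f = E.toCorr (E.ract x f) :=
  E.corrRactL_toCorr f x

theorem continuous_corrLact (E : TopologicalGraph V W) (f : C₀(V, ℂ)) :
    Continuous fun x => E.corrLact f x :=
  (E.corrLactL f).continuous

theorem continuous_corrRact (E : TopologicalGraph V W) (f : C₀(V, ℂ)) :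
    Continuous fun x => E.corrRact x f :=
  (E.corrRactL f).continuous

theorem Corr.continuous_ip {E : TopologicalGraph V W} {Z : Type*} [TopologicalSpace Z]
    {f g : Z → E.Corr} (hf : Continuous f) (hg : Continuous g) :
    Continuous fun z => E.corrIp (f z) (g z) :=
  E.continuous_corrIp.comp (hf.prodMk hg)

theorem norm_sq_corr (E : TopologicalGraph V W) (x : E.Corr) : ‖x‖ ^ 2 = ‖E.corrIp x x‖ :=
  E.denseRange_toCorr.induction_on x
    (isClosed_eq (continuous_norm.pow 2) (Corr.continuous_ip continuous_id continuous_id).norm)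
    fun x => by rw [norm_toCorr, corrIp_toCorr, Real.sq_sqrt (norm_nonneg _)]

/-- The graph correspondence `X(E)` over `C₀(V)`. -/
noncomputable instance (E : TopologicalGraph V W) : CStarCorrespondence C₀(V, ℂ) E.Corr where
  ract := E.corrRact
  lact := E.corrLact
  ip := E.corrIp
  ract_mul x f g := E.denseRange_toCorr.induction_on x
    (isClosed_eq (E.continuous_corrRact _)
      ((E.continuous_corrRact g).comp (E.continuous_corrRact f))) fun x => by
      simp only [corrRact_toCorr]
      congr 1
      ext e
      exact (mul_assoc _ _ _).symm
  lact_mul f g x := E.denseRange_toCorr.induction_on x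
    (isClosed_eq (E.continuous_corrLact _)
      ((E.continuous_corrLact f).comp (E.continuous_corrLact g))) fun x => by
      simp only [corrLact_toCorr]
      congr 1
      ext e
      exact mul_assoc _ _ _
  ip_add_right x y z := E.denseRange_toCorr.induction_on₃
    (p := fun x y z => E.corrIp x (y + z) = E.corrIp x y + E.corrIp x z)
    (isClosed_eq (Corr.continuous_ip (by fun_prop) (by fun_prop))
      ((Corr.continuous_ip (by fun_prop) (by fun_prop)).add
        (Corr.continuous_ip (by fun_prop) (by fun_prop))))
    (fun x y z => by rw [← map_add]; simp only [corrIp_toCorr, ip_add_right]) x y z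
  ip_smul_right c x y := E.denseRange_toCorr.induction_on₂
    (p := fun x y => E.corrIp x (c • y) = c • E.corrIp x y)
    (isClosed_eq (Corr.continuous_ip continuous_fst (continuous_snd.const_smul c))
      ((Corr.continuous_ip (by fun_prop) (by fun_prop)).const_smul c))
    (fun x y => by rw [← map_smul]; simp only [corrIp_toCorr, ip_smul_right]) x y
  ip_ract_right x y f := E.denseRange_toCorr.induction_on₂
    (p := fun x y => E.corrIp x (E.corrRact y f) = E.corrIp x y * f)
    (isClosed_eq (Corr.continuous_ip (by fun_prop) ((E.continuous_corrRact f).comp continuous_snd))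
      ((Corr.continuous_ip (by fun_prop) (by fun_prop)).mul continuous_const))
    (fun x y => by simp only [corrRact_toCorr, corrIp_toCorr, ip_ract_right]) x y
  star_ip x y := E.denseRange_toCorr.induction_on₂
    (p := fun x y => star (E.corrIp x y) = E.corrIp y x)
    (isClosed_eq ((Corr.continuous_ip (by fun_prop) (by fun_prop)).star)
      (Corr.continuous_ip (by fun_prop) (by fun_prop)))
    (fun x y => by simp only [corrIp_toCorr, star_ip]) x y
  ip_self_nonneg x := by
    refine ZeroAtInftyContinuousMap.exists_star_mul_self fun v => ?_
    have h : E.corrIp x x v ∈ Complex.ofReal '' Set.Ici 0 :=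
      E.denseRange_toCorr.induction_on (p := fun x => E.corrIp x x v ∈ Complex.ofReal '' Set.Ici 0)
        x ((Complex.isometry_ofReal.isClosedEmbedding.isClosedMap _ isClosed_Ici).preimage
          ((ZeroAtInftyContinuousMap.continuous_eval v).comp
            (Corr.continuous_ip continuous_id continuous_id))) fun x => by
          rw [corrIp_toCorr, E.ip_self_apply x.hasCompactSupport (subset_tsupport _)]
          exact ⟨_, Set.mem_Ici.2 (Finset.sum_nonneg fun _ _ => sq_nonneg _), rfl⟩
    obtain ⟨t, ht, h⟩ := h
    exact ⟨t, ht, h.symm⟩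
  eq_zero_of_ip_self x h := by
    have h1 := E.norm_sq_corr x
    rw [h, norm_zero] at h1
    exact norm_eq_zero.1 (pow_eq_zero_iff two_ne_zero |>.1 h1)
  norm_sq := E.norm_sq_corr
  ip_lact f x y := E.denseRange_toCorr.induction_on₂
    (p := fun x y => E.corrIp (E.corrLact (star f) y) x = E.corrIp y (E.corrLact f x))
    (isClosed_eq
      (Corr.continuous_ip ((E.continuous_corrLact _).comp continuous_snd) (by fun_prop))
      (Corr.continuous_ip (by fun_prop) ((E.continuous_corrLact _).comp continuous_fst)))
    (fun x y => by simp only [corrLact_toCorr, corrIp_toCorr, ip_lact]) x y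

end TopologicalGraph

/-- The `C*`-subalgebra of `B` generated by a subset. -/
def generatedCStar {B : Type w} [NonUnitalCStarAlgebra B] (S : Set B) :
    NonUnitalStarSubalgebra ℂ B :=
  (NonUnitalStarAlgebra.adjoin ℂ S).topologicalClosure

namespace CStarCorrespondence

/-- Toeplitz representations of a `C*`-correspondence `X` over `A` in a `C*`-algebra `B`. -/
structure ToeplitzRep (A : Type u) (X : Type v) [NonUnitalCStarAlgebra A] [NormedAddCommGroup X]
    [NormedSpace ℂ X] [CompleteSpace X] [CStarCorrespondence A X]
    (B : Type w) [NonUnitalCStarAlgebra B] where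
  psi : X →ₗ[ℂ] B
  pi : A →⋆ₙₐ[ℂ] B
  psi_lact : ∀ (a : A) (x : X), psi (lact a x) = pi a * psi x
  star_psi_mul_psi : ∀ x y : X, star (psi x) * psi y = pi (ip x y)

namespace ToeplitzRep

variable {A : Type u} {X : Type v} [NonUnitalCStarAlgebra A] [NormedAddCommGroup X]
  [NormedSpace ℂ X] [CompleteSpace X] [CStarCorrespondence A X]
  {B : Type w} [NonUnitalCStarAlgebra B]

/-- Every Toeplitz representation of `X` factors through `ρ`. -/
def IsUniversal (ρ : ToeplitzRep A X B) : Prop :=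
  ∀ (C : Type w) [NonUnitalCStarAlgebra C] (σ : ToeplitzRep A X C),
    ∃ h : B →⋆ₙₐ[ℂ] C, (∀ x, h (ρ.psi x) = σ.psi x) ∧ ∀ a, h (ρ.pi a) = σ.pi a

/-- The `C*`-algebra generated by the image of a representation. -/
def generated (ρ : ToeplitzRep A X B) : NonUnitalStarSubalgebra ℂ B :=
  generatedCStar (Set.range ρ.psi ∪ Set.range ρ.pi)

/-- The representation `ρ` exhibits `B` as the Toeplitz algebra of `X`: it is universal, and `B` is
generated by its image. -/
def IsToeplitzAlgebra (ρ : ToeplitzRep A X B) : Prop :=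
  ρ.IsUniversal ∧ ρ.generated = ⊤

end ToeplitzRep

end CStarCorrespondence

namespace TopologicalGraph

/-- Toeplitz representations of a topological graph in a `C*`-algebra `B`. -/
structure ToeplitzRep {V : Type u} {W : Type v} [TopologicalSpace V] [TopologicalSpace W]
    [T2Space V] [T2Space W] [LocallyCompactSpace W] (E : TopologicalGraph V W)
    (B : Type w) [NonUnitalCStarAlgebra B] where
  psi : C_c(W, ℂ) →ₗ[ℂ] B
  pi : C₀(V, ℂ) →⋆ₙₐ[ℂ] B
  psi_lact : ∀ (f : C₀(V, ℂ)) (x : C_c(W, ℂ)), psi (E.lact f x) = pi f * psi x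
  pi_hat : ∀ (x : C_c(W, ℂ)) (U : Set W), IsOpen U → ∀ (hU : E.IsSSection U)
    (hx : tsupport x ⊆ U),
    pi (E.hat x (hU.mono ((subset_tsupport x).trans hx))) = star (psi x) * psi x
  star_psi_mul_psi_of_disjoint : ∀ (x y : C_c(W, ℂ)) (U U' : Set W), IsOpen U → IsOpen U' →
    E.IsSSection U → E.IsSSection U' → Disjoint U U' → tsupport x ⊆ U → tsupport y ⊆ U' →
    star (psi x) * psi y = 0

namespace ToeplitzRep

variable {V : Type u} {W : Type v} [TopologicalSpace V] [TopologicalSpace W]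
  [T2Space V] [T2Space W] [LocallyCompactSpace W] {E : TopologicalGraph V W}
  {B : Type w} [NonUnitalCStarAlgebra B]

/-- Every Toeplitz representation of `E` factors through `ρ`. -/
def IsUniversal (ρ : E.ToeplitzRep B) : Prop :=
  ∀ (C : Type w) [NonUnitalCStarAlgebra C] (σ : E.ToeplitzRep C),
    ∃ h : B →⋆ₙₐ[ℂ] C, (∀ x, h (ρ.psi x) = σ.psi x) ∧ ∀ f, h (ρ.pi f) = σ.pi f

/-- The `C*`-algebra generated by the image of a representation. -/
def generated (ρ : E.ToeplitzRep B) : NonUnitalStarSubalgebra ℂ B :=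
  generatedCStar (Set.range ρ.psi ∪ Set.range ρ.pi)

end ToeplitzRep

end TopologicalGraph

/-! Representations of `E` and of `X(E)` carry the same information, because the graph relations
already force the whole inner product: every Toeplitz representation of `E` satisfies ψ(x)*ψ(y) =
π(⟨x, y⟩) for all x, y in `C_c(W)` (`TopologicalGraph.ToeplitzRep.star_psi_mul_psi`). By a partition
of unity, x and y may be assumed to be supported in open `s`-sections. If both lie in the same
section, the relation is the polarization of ψ(x)*ψ(x) = π(x̂). Otherwise y is cut into a piece
supported in the section of x, where the first case applies, and a piece supported away from
supp(x), where the disjointness relation makes both sides zero.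

The inner product relation bounds ψ by the norm of `X(E)`, so ψ extends to the completion
(`toCorrRep`), while restriction to `C_c(W)` (`ofCorrRep`) goes the other way. Hence the restriction
of a universal representation of `X(E)` is universal for `E`, and by density it generates the same
algebra. Any two universal representations of `E` give factorizations that invert each other on
generators.

For existence, the universal representation is a direct sum. The representations are too many to be
summed directly, so one is chosen for each norm that they induce on formal `*`-polynomials in the
elements of `X` and `A`. The sum dominates all these norms, and by `exists_hom_of_norm_eval_le`
domination of norms suffices to produce a `*`-homomorphism. -/

section GeneratedCStar

/-! ### Generated C*-subalgebras -/

variable {B : Type*} [NonUnitalCStarAlgebra B] {C : Type*} [NonUnitalCStarAlgebra C]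

/-- A `*`-homomorphism of C*-algebras is automatically contractive. This is what carries statements
checked on generators to the closure. -/
theorem NonUnitalStarAlgHom.continuous_of_cstar (f : B →⋆ₙₐ[ℂ] C) : Continuous f :=
  AddMonoidHomClass.continuous_of_bound f 1 fun b => by
    rw [one_mul]
    exact NonUnitalStarAlgHom.norm_apply_le f b

theorem subset_generatedCStar (S : Set B) : S ⊆ generatedCStar S :=
  (NonUnitalStarAlgebra.subset_adjoin ℂ S).trans
    (NonUnitalStarSubalgebra.le_topologicalClosure _)

theorem isClosed_generatedCStar (S : Set B) : IsClosed (generatedCStar S : Set B) :=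
  NonUnitalStarSubalgebra.isClosed_topologicalClosure _

theorem generatedCStar_le {S : Set B} {D : NonUnitalStarSubalgebra ℂ B}
    (hD : IsClosed (D : Set B)) (h : S ⊆ D) : generatedCStar S ≤ D :=
  NonUnitalStarSubalgebra.topologicalClosure_minimal _ (NonUnitalStarAlgebra.adjoin_le h) hD

/-- The `C*`-algebra generated by a subset, as a `C*`-algebra in its own right. -/
noncomputable instance (S : Set B) : NonUnitalCStarAlgebra (generatedCStar S) :=
  haveI : IsClosed (generatedCStar S : Set B) := isClosed_generatedCStar S
  NonUnitalStarSubalgebra.nonUnitalCStarAlgebra (generatedCStar S)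

/-- Two `*`-homomorphisms that agree on a set agree on the `C*`-algebra it generates. -/
theorem eqOn_generatedCStar {S : Set B} {f g : B →⋆ₙₐ[ℂ] C} (h : Set.EqOn f g S) :
    Set.EqOn f g (generatedCStar S) :=
  generatedCStar_le (D := NonUnitalStarAlgHom.equalizer f g)
    (isClosed_eq f.continuous_of_cstar g.continuous_of_cstar) h

/-- A `*`-homomorphism that maps a set into a closed subalgebra maps the `C*`-algebra generated by
the set into it. -/
theorem mapsTo_generatedCStar {S : Set B} {f : B →⋆ₙₐ[ℂ] C} {D : NonUnitalStarSubalgebra ℂ C}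
    (hD : IsClosed (D : Set C)) (h : Set.MapsTo f S D) :
    Set.MapsTo f (generatedCStar S) D :=
  generatedCStar_le (D := D.comap f) (hD.preimage f.continuous_of_cstar) h

/-- The generators generate the `C*`-algebra `generatedCStar S`. -/
theorem generatedCStar_preimage_val (S : Set B) :
    generatedCStar ((↑) ⁻¹' S : Set (generatedCStar S)) = ⊤ := by
  set R := generatedCStar ((↑) ⁻¹' S : Set (generatedCStar S)) with hR
  let f := NonUnitalStarSubalgebraClass.subtype (generatedCStar S)
  -- `R` is closed only inside the subalgebra. Its image is closed in `B` because the subalgebra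
  -- itself is, and only then does minimality of `generatedCStar S` apply.
  have hc : IsClosed (R.map f : Set B) := by
    rw [NonUnitalStarSubalgebra.coe_map]
    exact (isClosed_generatedCStar S).isClosedEmbedding_subtypeVal.isClosedMap _
      (isClosed_generatedCStar (B := generatedCStar S) _)
  have h : generatedCStar S ≤ R.map f := generatedCStar_le hc fun b hb =>
    ⟨⟨b, subset_generatedCStar S hb⟩, subset_generatedCStar _ hb, rfl⟩
  rw [NonUnitalStarAlgebra.eq_top_iff]
  rintro ⟨b, hb⟩
  obtain ⟨c, hc, rfl⟩ := h hb
  exact hc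

end GeneratedCStar

/-! ### Norms of `*`-polynomials and the construction of `*`-homomorphisms -/

/-- Formal `*`-polynomials without constant term in noncommuting variables indexed by `ι`. -/
inductive StarExpr (ι : Type u) : Type u
  | zero : StarExpr ι
  | var (i : ι) : StarExpr ι
  | add (p q : StarExpr ι) : StarExpr ι
  | mul (p q : StarExpr ι) : StarExpr ι
  | smul (c : ℂ) (p : StarExpr ι) : StarExpr ι
  | star (p : StarExpr ι) : StarExpr ι

namespace StarExpr

variable {ι : Type u} {B : Type*} [NonUnitalCStarAlgebra B] {C : Type*} [NonUnitalCStarAlgebra C]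

/-- The value of a `*`-polynomial at a family of elements of a `C*`-algebra. -/
noncomputable def eval (g : ι → B) : StarExpr ι → B
  | zero => 0
  | var i => g i
  | add p q => p.eval g + q.eval g
  | mul p q => p.eval g * q.eval g
  | smul c p => c • p.eval g
  | star p => Star.star (p.eval g)

theorem map_eval (f : B →⋆ₙₐ[ℂ] C) (g : ι → B) (p : StarExpr ι) :
    f (p.eval g) = p.eval fun i => f (g i) := by
  induction p with
  | zero => exact map_zero f
  | var i => rfl
  | add p q hp hq => rw [eval, map_add, hp, hq, eval]
  | mul p q hp hq => rw [eval, map_mul, hp, hq, eval]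
  | smul c p hp => rw [eval, map_smul, hp, eval]
  | star p hp => rw [eval, map_star, hp, eval]

/-- An expression knows only the index set and not the algebra, so this lets norms in two different
algebras be compared element by element. -/
theorem exists_eval_of_mem_adjoin (g : ι → B) {b : B}
    (hb : b ∈ NonUnitalStarAlgebra.adjoin ℂ (Set.range g)) : ∃ p : StarExpr ι, p.eval g = b := by
  induction hb using NonUnitalStarAlgebra.adjoin_induction with
  | mem x hx =>
    obtain ⟨i, rfl⟩ := hx
    exact ⟨var i, rfl⟩
  | zero => exact ⟨zero, rfl⟩
  | add x y _ _ hx hy =>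
    obtain ⟨p, rfl⟩ := hx
    obtain ⟨q, rfl⟩ := hy
    exact ⟨add p q, rfl⟩
  | mul x y _ _ hx hy =>
    obtain ⟨p, rfl⟩ := hx
    obtain ⟨q, rfl⟩ := hy
    exact ⟨mul p q, rfl⟩
  | smul c x _ hx =>
    obtain ⟨p, rfl⟩ := hx
    exact ⟨smul c p, rfl⟩
  | star x _ hx =>
    obtain ⟨p, rfl⟩ := hx
    exact ⟨star p, rfl⟩

end StarExpr

/-- If every `*`-polynomial has norm at `k` at most its norm at `g`, then `g i ↦ k i` extends to a
`*`-homomorphism of the `C*`-algebra generated by `g`. -/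
theorem exists_hom_of_norm_eval_le {ι : Type u} {B : Type*} [NonUnitalCStarAlgebra B] {C : Type*}
    [NonUnitalCStarAlgebra C] (g : ι → B) (k : ι → C)
    (h : ∀ p : StarExpr ι, ‖p.eval k‖ ≤ ‖p.eval g‖) :
    ∃ f : generatedCStar (Set.range g) →⋆ₙₐ[ℂ] C,
      ∀ i, f ⟨g i, subset_generatedCStar _ ⟨i, rfl⟩⟩ = k i := by
  -- The homomorphism is built through its graph: the algebra generated by the pairs `(g i, k i)`
  -- projects isometrically to `B`, and `f` is the inverse of that projection followed by the
  -- projection to `C`.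
  let gk : ι → B × C := fun i => (g i, k i)
  let G := generatedCStar (Set.range gk)
  let pr := (NonUnitalStarAlgHom.fst ℂ B C).comp (NonUnitalStarSubalgebraClass.subtype G)
  have hG : ∀ z ∈ G, ‖z.2‖ ≤ ‖z.1‖ := by
    intro z hz
    refine closure_minimal (t := {z : B × C | ‖z.2‖ ≤ ‖z.1‖}) ?_
      (isClosed_le continuous_snd.norm continuous_fst.norm) hz
    intro z hz
    obtain ⟨p, rfl⟩ := StarExpr.exists_eval_of_mem_adjoin gk hz
    have h1 := p.map_eval (NonUnitalStarAlgHom.fst ℂ B C) gk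
    have h2 := p.map_eval (NonUnitalStarAlgHom.snd ℂ B C) gk
    change ‖NonUnitalStarAlgHom.snd ℂ B C (p.eval gk)‖ ≤ ‖NonUnitalStarAlgHom.fst ℂ B C (p.eval gk)‖
    rw [h1, h2]
    exact h p
  -- The norm of the product is the maximum of the two norms, and on `G` the first one dominates.
  have hpr : Isometry pr := AddMonoidHomClass.isometry_of_norm pr fun z =>
    (max_eq_left (hG z z.2)).symm
  have hle : generatedCStar (Set.range g) ≤ NonUnitalStarAlgHom.range pr := by
    refine generatedCStar_le ?_ ?_
    · rw [NonUnitalStarAlgHom.coe_range]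
      exact hpr.isClosedEmbedding.isClosed_range
    · rintro _ ⟨i, rfl⟩
      exact ⟨⟨gk i, subset_generatedCStar _ ⟨i, rfl⟩⟩, rfl⟩
  let e := StarAlgEquiv.ofInjective' pr hpr.injective
  refine ⟨((NonUnitalStarAlgHom.snd ℂ B C).comp (NonUnitalStarSubalgebraClass.subtype G)).comp
    ((e.symm : _ →⋆ₙₐ[ℂ] G).comp (NonUnitalStarSubalgebra.inclusion hle)), fun i => ?_⟩
  have hi : e.symm (NonUnitalStarSubalgebra.inclusion hle
      ⟨g i, subset_generatedCStar _ ⟨i, rfl⟩⟩) = ⟨gk i, subset_generatedCStar _ ⟨i, rfl⟩⟩ := by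
    rw [StarAlgEquiv.symm_apply_eq]
    exact Subtype.ext rfl
  exact congrArg (fun z : G => z.1.2) hi

/-! ### Existence of the Toeplitz algebra of a correspondence -/

namespace CStarCorrespondence.ToeplitzRep

variable {A : Type u} {X : Type v} [NonUnitalCStarAlgebra A] [NormedAddCommGroup X]
  [NormedSpace ℂ X] [CompleteSpace X] [CStarCorrespondence A X]
  {B : Type w} [NonUnitalCStarAlgebra B]

/-- The C*-identity gives ‖ψ(x)‖² = ‖π(⟨x, x⟩)‖ ≤ ‖x‖². The bound does not depend on the
representation, so families of representations have bounded direct sums. -/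
theorem norm_psi_le (ρ : ToeplitzRep A X B) (x : X) : ‖ρ.psi x‖ ≤ ‖x‖ := by
  refine abs_le_of_sq_le_sq' ?_ (norm_nonneg x) |>.2
  rw [norm_sq (A := A) x, sq, ← CStarRing.norm_star_mul_self, ρ.star_psi_mul_psi]
  exact NonUnitalStarAlgHom.norm_apply_le ρ.pi _

theorem continuous_psi (ρ : ToeplitzRep A X B) : Continuous ρ.psi :=
  AddMonoidHomClass.continuous_of_bound ρ.psi 1 fun x => by
    rw [one_mul]
    exact ρ.norm_psi_le x

/-- The images of all elements of `X` and of `A` under a representation. -/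
def generators (ρ : ToeplitzRep A X B) : X ⊕ A → B :=
  Sum.elim ρ.psi ρ.pi

theorem generated_eq (ρ : ToeplitzRep A X B) :
    ρ.generated = generatedCStar (Set.range ρ.generators) := by
  rw [generated, generators, Set.Sum.elim_range]

/-- A representation, considered as a representation in a subalgebra that contains its image. -/
noncomputable def codRestrict (ρ : ToeplitzRep A X B) :
    ToeplitzRep A X (generatedCStar (Set.range ρ.generators)) where
  psi :=
    { toFun := fun x => ⟨ρ.psi x, subset_generatedCStar _ ⟨Sum.inl x, rfl⟩⟩
      map_add' := fun x y => Subtype.ext (map_add ρ.psi x y)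
      map_smul' := fun c x => Subtype.ext (map_smul ρ.psi c x) }
  pi := NonUnitalStarAlgHom.codRestrict ρ.pi _ fun a =>
    subset_generatedCStar _ ⟨Sum.inr a, rfl⟩
  psi_lact a x := Subtype.ext (ρ.psi_lact a x)
  star_psi_mul_psi x y := Subtype.ext (ρ.star_psi_mul_psi x y)

theorem codRestrict_generated (ρ : ToeplitzRep A X B) : ρ.codRestrict.generated = ⊤ := by
  rw [generated_eq, ← generatedCStar_preimage_val]
  congr 1
  ext ⟨b, hb⟩
  constructor
  · rintro ⟨i | i, h⟩
    · exact ⟨Sum.inl i, congrArg Subtype.val h⟩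
    · exact ⟨Sum.inr i, congrArg Subtype.val h⟩
  · rintro ⟨i | i, h⟩
    · exact ⟨Sum.inl i, Subtype.ext h⟩
    · exact ⟨Sum.inr i, Subtype.ext h⟩

/-- The direct sum of a family of representations. -/
noncomputable def directSum {I : Type*} {D : I → Type*} [∀ i, NonUnitalCStarAlgebra (D i)]
    (σ : ∀ i, ToeplitzRep A X (D i)) : ToeplitzRep A X (lp D ⊤) where
  psi :=
    { toFun := fun x => ⟨fun i => (σ i).psi x, memℓp_infty ⟨‖x‖, by
        rintro _ ⟨i, rfl⟩
        exact (σ i).norm_psi_le x⟩⟩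
      map_add' := fun x y => lp.ext (funext fun i => map_add (σ i).psi x y)
      map_smul' := fun c x => lp.ext (funext fun i => map_smul (σ i).psi c x) }
  pi :=
    { toFun := fun a => ⟨fun i => (σ i).pi a, memℓp_infty ⟨‖a‖, by
        rintro _ ⟨i, rfl⟩
        exact NonUnitalStarAlgHom.norm_apply_le (σ i).pi a⟩⟩
      map_smul' := fun c x => lp.ext (funext fun i => map_smul (σ i).pi c x)
      map_zero' := lp.ext (funext fun i => map_zero (σ i).pi)
      map_add' := fun x y => lp.ext (funext fun i => map_add (σ i).pi x y)
      map_mul' := fun x y => lp.ext (funext fun i => map_mul (σ i).pi x y)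
      map_star' := fun x => lp.ext (funext fun i => map_star (σ i).pi x) }
  psi_lact a x := lp.ext (funext fun i => (σ i).psi_lact a x)
  star_psi_mul_psi x y := lp.ext (funext fun i => (σ i).star_psi_mul_psi x y)

/-- Operations in the direct sum are coordinatewise, so the norm of a polynomial at any summand is
at most its norm at the sum. -/
theorem eval_directSum {I : Type*} {D : I → Type*} [∀ i, NonUnitalCStarAlgebra (D i)]
    (σ : ∀ i, ToeplitzRep A X (D i)) (p : StarExpr (X ⊕ A)) (i : I) :
    p.eval (directSum σ).generators i = p.eval (σ i).generators := by
  induction p with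
  | zero => rfl
  | var j => cases j <;> rfl
  | add p q hp hq => exact congrArg₂ (· + ·) hp hq
  | mul p q hp hq => exact congrArg₂ (· * ·) hp hq
  | smul c p hp => exact congrArg (c • ·) hp
  | star p hp => exact congrArg Star.star hp

variable (A X) in
/-- The norms on `*`-polynomials in the elements of `X` and `A` which are given by the
representations of `X`. -/
def norms : Set (StarExpr (X ⊕ A) → ℝ) :=
  {N | ∃ (D : Type (max u v)) (_ : NonUnitalCStarAlgebra D) (σ : ToeplitzRep A X D),
    N = fun p => ‖p.eval σ.generators‖}

variable (A X) in
/-- Every `C*`-correspondence has a Toeplitz algebra. -/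
theorem exists_isToeplitzAlgebra :
    ∃ (T : Type (max u v)) (_ : NonUnitalCStarAlgebra T) (i : ToeplitzRep A X T),
      i.IsToeplitzAlgebra := by
  -- Norms, unlike representations, form a set in the universe `max u v`, so the direct sum indexed
  -- by them stays in that universe.
  choose D instD σ hσ using fun N : norms A X => N.2
  let ρ := directSum σ
  refine ⟨_, inferInstance, ρ.codRestrict, fun C _ τ => ?_, ρ.codRestrict_generated⟩
  obtain ⟨f, hf⟩ := exists_hom_of_norm_eval_le ρ.generators τ.generators fun p => by
    -- `τ` itself need not be a summand, but the summand chosen for its norm gives every polynomial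
    -- the same norm.
    let N : norms A X := ⟨_, C, inferInstance, τ, rfl⟩
    have h1 : ‖p.eval τ.generators‖ = ‖p.eval (σ N).generators‖ := congrFun (hσ N) p
    rw [h1, ← eval_directSum σ p N]
    exact lp.norm_apply_le_norm ENNReal.top_ne_zero _ N
  exact ⟨f, fun x => hf (Sum.inl x), fun a => hf (Sum.inr a)⟩

end CStarCorrespondence.ToeplitzRep

/-! ### Decomposition of `C_c(W)` along `s`-sections -/

namespace TopologicalGraph

section Sections

variable {V : Type u} {W : Type v} [TopologicalSpace V] [TopologicalSpace W]

theorem isSSection_source (E : TopologicalGraph V W) (φ : OpenPartialHomeomorph W V)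
    (hφ : E.s = φ) : E.IsSSection φ.source := by
  rw [IsSSection, hφ]
  exact φ.isOpenEmbedding_restrict.isEmbedding

/-- The pointwise product of a real continuous function and an element of `C_c(W)`. -/
noncomputable def cutoff (f : C(W, ℝ)) (x : C_c(W, ℂ)) : C_c(W, ℂ) where
  toFun e := (f e : ℂ) * x e
  continuous_toFun := (Complex.continuous_ofReal.comp f.continuous).mul (map_continuous x)
  hasCompactSupport' := x.hasCompactSupport.mul_left

theorem cutoff_apply (f : C(W, ℝ)) (x : C_c(W, ℂ)) (e : W) : cutoff f x e = f e * x e := rfl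

theorem tsupport_cutoff_subset_left (f : C(W, ℝ)) (x : C_c(W, ℂ)) :
    tsupport (cutoff f x) ⊆ tsupport f :=
  closure_mono fun e he h => he (by rw [cutoff_apply, h, Complex.ofReal_zero, zero_mul])

theorem tsupport_cutoff_subset_right (f : C(W, ℝ)) (x : C_c(W, ℂ)) :
    tsupport (cutoff f x) ⊆ tsupport x :=
  closure_mono fun e he h => he (by rw [cutoff_apply, h, mul_zero])

/-- Every element of `C_c(W)` is a finite sum of elements supported in open `s`-sections. -/
theorem exists_eq_sum_of_sections [T2Space W] [LocallyCompactSpace W] (E : TopologicalGraph V W)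
    (x : C_c(W, ℂ)) : ∃ (n : ℕ) (y : Fin n → C_c(W, ℂ)), x = ∑ i, y i ∧
      ∀ i, ∃ U, IsOpen U ∧ E.IsSSection U ∧ tsupport (y i) ⊆ U := by
  choose φ hφ hs using E.isLocalHomeomorph_s
  have hK : IsCompact (tsupport x) := x.hasCompactSupport
  obtain ⟨t, ht⟩ := hK.elim_nhds_subcover' (fun e _ => (φ e).source)
    (fun e _ => (φ e).open_source.mem_nhds (hφ e))
  let c : Fin t.card → W := fun i => (t.equivFin.symm i).1.1
  obtain ⟨f, hf, hsum, -, -⟩ := exists_continuous_sum_one_of_isOpen_isCompact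
    (s := fun i => (φ (c i)).source) (fun i => (φ (c i)).open_source) hK (by
      intro e he
      obtain ⟨a, ha, h⟩ := Set.mem_iUnion₂.1 (ht he)
      exact Set.mem_iUnion.2 ⟨t.equivFin ⟨a, ha⟩, by simpa [c] using h⟩)
  refine ⟨t.card, fun i => cutoff (f i) x, ?_, fun i => ⟨(φ (c i)).source, (φ (c i)).open_source,
    E.isSSection_source _ (hs _), (tsupport_cutoff_subset_left _ _).trans (hf i)⟩⟩
  ext e
  rw [CompactlySupportedContinuousMap.sum_apply]
  simp_rw [cutoff_apply]
  rw [← Finset.sum_mul, ← Complex.ofReal_sum]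
  -- The weights are known to sum to 1 only on supp(x); off it both sides vanish.
  by_cases he : x e = 0
  · rw [he, mul_zero]
  · have h1 : ∑ i, f i e = 1 := by simpa using hsum (subset_tsupport _ he)
    rw [h1, Complex.ofReal_one, one_mul]

end Sections

variable {V : Type u} {W : Type v} [TopologicalSpace V] [TopologicalSpace W]
  [T2Space V] [T2Space W] [LocallyCompactSpace W]

theorem ip_eq_zero_of_forall (E : TopologicalGraph V W) {x y : C_c(W, ℂ)}
    (h : ∀ e, x e = 0 ∨ y e = 0) : E.ip x y = 0 := by
  ext v
  rw [ip_apply, ZeroAtInftyContinuousMap.zero_apply]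
  refine finsum_mem_of_eqOn_zero fun e _ => ?_
  rcases h e with h | h <;> simp [h]

theorem ip_eq_zero_of_disjoint (E : TopologicalGraph V W) {x y : C_c(W, ℂ)} {U U' : Set W}
    (hd : Disjoint U U') (hx : tsupport x ⊆ U) (hy : tsupport y ⊆ U') : E.ip x y = 0 := by
  refine E.ip_eq_zero_of_forall fun e => ?_
  by_contra h
  rw [not_or] at h
  exact Set.disjoint_left.1 hd (hx (subset_tsupport _ h.1)) (hy (subset_tsupport _ h.2))

/-- On an `s`-section every fibre of `s` meets the support of `x` at most once, so the fibre sum has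
at most one nonzero term. Thus `pi_hat` becomes the diagonal case of the inner product relation. -/
theorem hat_eq_ip (E : TopologicalGraph V W) (x : C_c(W, ℂ))
    (hx : E.IsSSection (Function.support x)) : E.hat x hx = E.ip x x :=
  DFunLike.coe_injective (E.hatFun_eq_ip x hx)

theorem ip_sum_left (E : TopologicalGraph V W) {n : ℕ} (x : Fin n → C_c(W, ℂ)) (y : C_c(W, ℂ)) :
    E.ip (∑ i, x i) y = ∑ i, E.ip (x i) y :=
  map_sum (AddMonoidHom.mk' (fun x => E.ip x y) fun x x' => E.ip_add_left x x' y) x _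

theorem ip_sum_right (E : TopologicalGraph V W) {n : ℕ} (x : C_c(W, ℂ)) (y : Fin n → C_c(W, ℂ)) :
    E.ip x (∑ i, y i) = ∑ i, E.ip x (y i) :=
  map_sum (AddMonoidHom.mk' (fun y => E.ip x y) fun y y' => E.ip_add_right x y y') y _

/-! ### The graph relations imply the inner product relation -/

namespace ToeplitzRep

variable {E : TopologicalGraph V W} {B : Type w} [NonUnitalCStarAlgebra B]

theorem star_psi_mul_self (ρ : E.ToeplitzRep B) {U : Set W} (hU : IsOpen U) (hs : E.IsSSection U)
    {x : C_c(W, ℂ)} (hx : tsupport x ⊆ U) : star (ρ.psi x) * ρ.psi x = ρ.pi (E.ip x x) := by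
  rw [← ρ.pi_hat x U hU hs hx, hat_eq_ip]

/-- Polarization of `star_psi_mul_self`. -/
theorem star_psi_mul_psi_of_section (ρ : E.ToeplitzRep B) {U : Set W} (hU : IsOpen U)
    (hs : E.IsSSection U) {x y : C_c(W, ℂ)} (hx : tsupport x ⊆ U) (hy : tsupport y ⊆ U) :
    star (ρ.psi x) * ρ.psi y = ρ.pi (E.ip x y) := by
  have key : ∀ c : ℂ, c • (star (ρ.psi x) * ρ.psi y - ρ.pi (E.ip x y)) +
      conj c • (star (ρ.psi y) * ρ.psi x - ρ.pi (E.ip y x)) = 0 := by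
    intro c
    have hcy : tsupport (c • y) ⊆ U :=
      (closure_mono fun e he => right_ne_zero_of_mul (show c * y e ≠ 0 from he)).trans hy
    have h := ρ.star_psi_mul_self hU hs (x := x + c • y)
      ((tsupport_add (⇑x) (⇑(c • y))).trans (Set.union_subset hx hcy))
    have h1 := ρ.star_psi_mul_self hU hs hx
    have h2 := ρ.star_psi_mul_self hU hs hcy
    rw [E.ip_add_left, E.ip_add_right, E.ip_add_right, map_add, map_add, map_add, map_add,
      star_add, add_mul, mul_add, mul_add, h1, h2, E.ip_smul_right c x y, E.ip_smul_left c y x,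
      map_smul ρ.pi c, map_smul ρ.pi (conj c), map_smul ρ.psi, mul_smul_comm, star_smul,
      smul_mul_assoc, Complex.star_def] at h
    rw [smul_sub, smul_sub]
    have h' := sub_eq_zero.2 h
    rw [← h']
    abel
  -- Write d(x, y) for the defect ψ(x)*ψ(y) − π(⟨x, y⟩). Taking c = 1 gives d(x, y) + d(y, x) = 0,
  -- and c = i gives d(x, y) = d(y, x).
  have h1 := key 1
  have h2 := key Complex.I
  rw [map_one, one_smul, one_smul] at h1
  rw [Complex.conj_I, neg_smul, ← sub_eq_add_neg, ← smul_sub, smul_eq_zero] at h2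
  have h3 := h2.resolve_left Complex.I_ne_zero
  have h4 : (2 : ℂ) • (star (ρ.psi x) * ρ.psi y - ρ.pi (E.ip x y)) = 0 := by
    rw [two_smul]
    nth_rewrite 2 [sub_eq_zero.1 h3]
    exact h1
  exact sub_eq_zero.1 ((smul_eq_zero.1 h4).resolve_left two_ne_zero)

/-- The two sections may overlap, so neither the polarized relation nor the disjointness relation
applies to `y` as a whole; a cutoff equal to 1 near supp(x) splits `y` into one piece for each. -/
theorem star_psi_mul_psi_of_sections (ρ : E.ToeplitzRep B) {U U' : Set W} (hU : IsOpen U)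
    (hs : E.IsSSection U) (hU' : IsOpen U') (hs' : E.IsSSection U') {x y : C_c(W, ℂ)}
    (hx : tsupport x ⊆ U) (hy : tsupport y ⊆ U') :
    star (ρ.psi x) * ρ.psi y = ρ.pi (E.ip x y) := by
  -- Two nested neighbourhoods of supp(x) are needed. The remainder (1 − f)y vanishes on `N`, so its
  -- closed support misses the closure of the smaller `N'`; then `N'` and `U' \ closure N'` are
  -- disjoint open `s`-sections containing the two supports.
  obtain ⟨N, hN, hxN, hNU, hNc⟩ :=
    exists_open_between_and_isCompact_closure x.hasCompactSupport.isCompact hU hx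
  obtain ⟨N', hN', hxN', hNN', -⟩ :=
    exists_open_between_and_isCompact_closure x.hasCompactSupport.isCompact hN hxN
  obtain ⟨f, hf1, -, hfU, -⟩ := exists_continuousMap_one_of_isCompact_subset_isOpen hNc hU hNU
  have hsum : y = cutoff f y + cutoff (1 - f) y := by
    ext e
    rw [CompactlySupportedContinuousMap.add_apply, cutoff_apply, cutoff_apply, ← add_mul,
      ← Complex.ofReal_add]
    simp
  have hd : Disjoint N' (U' \ closure N') :=
    Set.disjoint_sdiff_right.mono_left subset_closure
  have hy2 : tsupport (cutoff (1 - f) y) ⊆ U' \ closure N' := by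
    refine Set.subset_sdiff.2 ⟨(tsupport_cutoff_subset_right _ _).trans hy, ?_⟩
    have h : tsupport (cutoff (1 - f) y) ⊆ Nᶜ := by
      refine closure_minimal (fun e he heN => he ?_) hN.isClosed_compl
      rw [cutoff_apply, ContinuousMap.sub_apply, hf1 (subset_closure heN)]
      simp
    exact (disjoint_compl_left.mono_left h).mono_right hNN'
  have hdiff : IsOpen (U' \ closure N') := hU'.sdiff isClosed_closure
  rw [hsum, map_add, mul_add, E.ip_add_right, map_add,
    ρ.star_psi_mul_psi_of_section hU hs hx ((tsupport_cutoff_subset_left _ _).trans hfU),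
    ρ.star_psi_mul_psi_of_disjoint x _ N' _ hN' hdiff
      (hs.mono ((subset_closure.trans hNN').trans (subset_closure.trans hNU)))
      (hs'.mono Set.sdiff_subset) hd hxN' hy2, E.ip_eq_zero_of_disjoint hd hxN' hy2, map_zero]

/-- A Toeplitz representation of a topological graph respects the inner product on `C_c(W)`. -/
theorem star_psi_mul_psi (ρ : E.ToeplitzRep B) (x y : C_c(W, ℂ)) :
    star (ρ.psi x) * ρ.psi y = ρ.pi (E.ip x y) := by
  obtain ⟨m, x', rfl, hx⟩ := E.exists_eq_sum_of_sections x
  obtain ⟨n, y', rfl, hy⟩ := E.exists_eq_sum_of_sections y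
  rw [map_sum, map_sum, star_sum, Finset.sum_mul, ip_sum_left, map_sum]
  refine Finset.sum_congr rfl fun i _ => ?_
  rw [Finset.mul_sum, ip_sum_right, map_sum]
  refine Finset.sum_congr rfl fun j _ => ?_
  obtain ⟨U, hU, hs, h⟩ := hx i
  obtain ⟨U', hU', hs', h'⟩ := hy j
  exact ρ.star_psi_mul_psi_of_sections hU hs hU' hs' h h'

/-! ### Passage between representations of `E` and of `X(E)` -/

theorem norm_psi_le (ρ : E.ToeplitzRep B) (x : C_c(W, ℂ)) : ‖ρ.psi x‖ ≤ 1 * ‖E.toCorr x‖ := by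
  rw [one_mul, norm_toCorr]
  refine Real.le_sqrt_of_sq_le ?_
  rw [sq, ← CStarRing.norm_star_mul_self, ρ.star_psi_mul_psi]
  exact NonUnitalStarAlgHom.norm_apply_le ρ.pi _

theorem extendOfNorm_toCorr (ρ : E.ToeplitzRep B) (x : C_c(W, ℂ)) :
    ρ.psi.extendOfNorm E.toCorr (E.toCorr x) = ρ.psi x :=
  LinearMap.extendOfNorm_eq E.denseRange_toCorr ⟨1, ρ.norm_psi_le⟩ x

/-- The extension of a Toeplitz representation of `E` to the graph correspondence `X(E)`. -/
noncomputable def toCorrRep (ρ : E.ToeplitzRep B) :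
    CStarCorrespondence.ToeplitzRep C₀(V, ℂ) E.Corr B where
  psi := (ρ.psi.extendOfNorm E.toCorr).toLinearMap
  pi := ρ.pi
  psi_lact f x := E.denseRange_toCorr.induction_on
    (p := fun x => ρ.psi.extendOfNorm E.toCorr (E.corrLact f x) =
      ρ.pi f * ρ.psi.extendOfNorm E.toCorr x) x
    (isClosed_eq ((ContinuousLinearMap.continuous _).comp (E.continuous_corrLact f))
      (continuous_const.mul (ContinuousLinearMap.continuous _))) fun x => by
      rw [corrLact_toCorr, extendOfNorm_toCorr, extendOfNorm_toCorr, ρ.psi_lact]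
  star_psi_mul_psi x y := E.denseRange_toCorr.induction_on₂
    (p := fun x y => star (ρ.psi.extendOfNorm E.toCorr x) * ρ.psi.extendOfNorm E.toCorr y =
      ρ.pi (E.corrIp x y))
    (isClosed_eq (by fun_prop) (ρ.pi.continuous_of_cstar.comp E.continuous_corrIp))
    (fun x y => by
      rw [corrIp_toCorr, extendOfNorm_toCorr, extendOfNorm_toCorr, ρ.star_psi_mul_psi]) x y

theorem toCorrRep_psi_toCorr (ρ : E.ToeplitzRep B) (x : C_c(W, ℂ)) :
    ρ.toCorrRep.psi (E.toCorr x) = ρ.psi x :=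
  ρ.extendOfNorm_toCorr x

/-- The restriction to `C_c(W)` of a Toeplitz representation of the graph correspondence. -/
noncomputable def ofCorrRep (i : CStarCorrespondence.ToeplitzRep C₀(V, ℂ) E.Corr B) :
    E.ToeplitzRep B where
  psi := i.psi ∘ₗ E.toCorr
  pi := i.pi
  psi_lact f x := by
    have h := i.psi_lact f (E.toCorr x)
    rwa [show CStarCorrespondence.lact f (E.toCorr x) = E.toCorr (E.lact f x) from
      E.corrLact_toCorr f x] at h
  pi_hat x U hU hs hx := by
    rw [hat_eq_ip, ← corrIp_toCorr]
    exact (i.star_psi_mul_psi _ _).symm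
  star_psi_mul_psi_of_disjoint x y U U' _ _ _ _ hd hx hy := by
    have h := i.star_psi_mul_psi (E.toCorr x) (E.toCorr y)
    rwa [show CStarCorrespondence.ip (E.toCorr x) (E.toCorr y) = E.ip x y from
      E.corrIp_toCorr x y, E.ip_eq_zero_of_disjoint hd hx hy, map_zero] at h

/-- A representation of `E` is extended to `X(E)`, factored through `i` there, and restricted again;
the extension agrees with the original on `C_c(W)`. -/
theorem ofCorrRep_isUniversal {i : CStarCorrespondence.ToeplitzRep C₀(V, ℂ) E.Corr B}
    (hi : i.IsUniversal) : (ofCorrRep i).IsUniversal := by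
  intro C _ σ
  obtain ⟨h, h1, h2⟩ := hi C σ.toCorrRep
  exact ⟨h, fun x => (h1 _).trans (σ.toCorrRep_psi_toCorr x), h2⟩

theorem isClosed_generated (ρ : E.ToeplitzRep B) : IsClosed (ρ.generated : Set B) :=
  isClosed_generatedCStar _

theorem psi_mem_generated (ρ : E.ToeplitzRep B) (x : C_c(W, ℂ)) : ρ.psi x ∈ ρ.generated :=
  subset_generatedCStar _ (Or.inl ⟨x, rfl⟩)

theorem pi_mem_generated (ρ : E.ToeplitzRep B) (f : C₀(V, ℂ)) : ρ.pi f ∈ ρ.generated :=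
  subset_generatedCStar _ (Or.inr ⟨f, rfl⟩)

/-- `C_c(W)` is dense in `X(E)` and ψ is continuous, so the elements lost by restriction are
recovered in the closure. -/
theorem ofCorrRep_generated (i : CStarCorrespondence.ToeplitzRep C₀(V, ℂ) E.Corr B) :
    (ofCorrRep i).generated = i.generated := by
  refine le_antisymm (generatedCStar_le (isClosed_generatedCStar _) ?_)
    (generatedCStar_le (isClosed_generated _) ?_)
  · refine Set.Subset.trans (Set.union_subset_union_left _ ?_) (subset_generatedCStar _)
    rintro _ ⟨x, rfl⟩
    exact ⟨E.toCorr x, rfl⟩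
  · rintro _ (⟨x, rfl⟩ | ⟨f, rfl⟩)
    · exact E.denseRange_toCorr.induction_on (p := fun x => i.psi x ∈ (ofCorrRep i).generated) x
        ((isClosed_generated _).preimage i.continuous_psi) (psi_mem_generated (ofCorrRep i))
    · exact pi_mem_generated (ofCorrRep i) f

/-! ### Uniqueness of the generated algebra -/

/-- Universal Toeplitz representations generate isomorphic `C*`-algebras. -/
theorem IsUniversal.nonempty_starAlgEquiv {T : Type w} [NonUnitalCStarAlgebra T]
    {ρ : E.ToeplitzRep B} (hρ : ρ.IsUniversal) {j : E.ToeplitzRep T} (hj : j.IsUniversal)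
    (hg : j.generated = ⊤) : Nonempty (ρ.generated ≃⋆ₐ[ℂ] T) := by
  obtain ⟨h, h1, h2⟩ := hρ T j
  obtain ⟨k, k1, k2⟩ := hj B ρ
  have hk : ∀ t, k t ∈ ρ.generated := fun t => by
    have ht : t ∈ j.generated := hg ▸ NonUnitalStarAlgebra.mem_top
    refine mapsTo_generatedCStar ρ.isClosed_generated ?_ ht
    rintro _ (⟨x, rfl⟩ | ⟨f, rfl⟩)
    · rw [k1]
      exact ρ.psi_mem_generated x
    · rw [k2]
      exact ρ.pi_mem_generated f
  have hhk : ∀ t, h (k t) = t := fun t => by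
    have ht : t ∈ j.generated := hg ▸ NonUnitalStarAlgebra.mem_top
    refine eqOn_generatedCStar (f := h.comp k) (g := NonUnitalStarAlgHom.id ℂ T) ?_ ht
    rintro _ (⟨x, rfl⟩ | ⟨f, rfl⟩)
    · exact (congrArg h (k1 x)).trans (h1 x)
    · exact (congrArg h (k2 f)).trans (h2 f)
  -- This holds only on the generated algebra: `B` may be larger, and universality says nothing
  -- about `h` outside it.
  have hkh : ∀ b ∈ ρ.generated, k (h b) = b := fun b hb => by
    refine eqOn_generatedCStar (f := k.comp h) (g := NonUnitalStarAlgHom.id ℂ B) ?_ hb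
    rintro _ (⟨x, rfl⟩ | ⟨f, rfl⟩)
    · exact (congrArg k (h1 x)).trans (k1 x)
    · exact (congrArg k (h2 f)).trans (k2 f)
  exact ⟨StarAlgEquiv.ofNonUnitalStarAlgHom
    (h.comp (NonUnitalStarSubalgebraClass.subtype ρ.generated))
    (NonUnitalStarAlgHom.codRestrict k ρ.generated hk)
    (NonUnitalStarAlgHom.ext fun b => Subtype.ext (hkh b b.2))
    (NonUnitalStarAlgHom.ext hhk)⟩

end ToeplitzRep

end TopologicalGraph

theorem mainTheorem2 {V : Type u} {W : Type v} [TopologicalSpace V] [TopologicalSpace W]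
    [LocallyCompactSpace V] [LocallyCompactSpace W] [T2Space V] [T2Space W]
    (E : TopologicalGraph V W) :
    -- the Toeplitz algebra `T(E)` of the graph correspondence `X(E)` exists
    (∃ (T : Type (max u v)) (_ : NonUnitalCStarAlgebra T)
      (i : CStarCorrespondence.ToeplitzRep C₀(V, ℂ) E.Corr T), i.IsToeplitzAlgebra) ∧
    -- and, for `T(E)` with its universal representation `i` of `X(E)`,
    ∀ (T : Type (max u v)) [NonUnitalCStarAlgebra T]
      (i : CStarCorrespondence.ToeplitzRep C₀(V, ℂ) E.Corr T), i.IsToeplitzAlgebra →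
      -- a universal Toeplitz representation of `E`, the restriction of `i`, generates `T(E)`
      (∃ j : E.ToeplitzRep T, (∀ x, j.psi x = i.psi (E.toCorr x)) ∧ j.pi = i.pi ∧
        j.IsUniversal ∧ j.generated = ⊤) ∧
      -- any universal Toeplitz representation of `E` generates a copy of `T(E)`
      ∀ (B : Type (max u v)) [NonUnitalCStarAlgebra B] (ρ : E.ToeplitzRep B), ρ.IsUniversal →
        Nonempty (ρ.generated ≃⋆ₐ[ℂ] T) := by
  refine ⟨CStarCorrespondence.ToeplitzRep.exists_isToeplitzAlgebra _ _, fun T _ i hi => ?_⟩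
  have hu := TopologicalGraph.ToeplitzRep.ofCorrRep_isUniversal hi.1
  have hg := (TopologicalGraph.ToeplitzRep.ofCorrRep_generated i).trans hi.2
  exact ⟨⟨.ofCorrRep i, fun _ => rfl, rfl, hu, hg⟩, fun B _ ρ hρ =>
    hρ.nonempty_starAlgEquiv hu hg⟩
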